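/- Let $G$ be a finite simple graph with $n\ge 1$ vertices and Euler genus $g$. Then $$\mathrm{qn}(G) < \mathrm{tn}(G) \le 6g + 9\bigl(1+\log_{3/2} n\bigr).$$ Here the Euler genus of $G$ is the minimum of $2-\chi(\Sigma)$ over all closed connected surfaces $\Sigma$ (orientable or not) in which $G$ embeds, where $\chi(\Sigma)$ is the Euler characteristic. The queue-number $\mathrm{qn}(G)$ is the minimum $k$ such that there are a linear ordering $\prec$ of $V(G)$ and a partition of $E(G)$ into $k$ (possibly empty) sets, none of which contains two edges $vw$, $xy$ that are nested, i.e. with $v\prec x\prec y\prec w$. The track-number $\mathrm{tn}(G)$ is the minimum $t$ such that there are a proper colouring of the vertices of $G$ with $t$ colours and a total order $\prec_i$ on each colour class $V_i$ without X-crossings, where an X-crossing consists of edges $vw$ and $xy$ and distinct colours $i\neq j$ with $v,x\in V_i$, $w,y\in V_j$, $v\prec_i x$ and $y\prec_j w$. -/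

import Mathlib

namespace GraphLayout

/-- A cellular decomposition of a closed connected surface (orientable or not), encoded by its
flags, i.e. by the triangles of its barycentric subdivision. Each flag is a mutually incident
(vertex, edge, face) triple counted with sides; `s₀`, `s₁`, `s₂` send a flag to the flag across,
changing only the vertex, only the edge, only the face, respectively. Loops and parallel edges
are allowed. Gluing one triangle per flag along these three involutions gives a closed
surface: fixed-point freeness means that there is no boundary, and the conditions on `s₀`, `s₂`
say that each edge carries exactly four flags (two ends, two sides). -/
structure SurfaceMap (Φ : Type) where
  s₀ : Φ → Φ
  s₁ : Φ → Φ
  s₂ : Φ → Φ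
  invol₀ : ∀ x, s₀ (s₀ x) = x
  invol₁ : ∀ x, s₁ (s₁ x) = x
  invol₂ : ∀ x, s₂ (s₂ x) = x
  ne₀ : ∀ x, s₀ x ≠ x
  ne₁ : ∀ x, s₁ x ≠ x
  ne₂ : ∀ x, s₂ x ≠ x
  comm₀₂ : ∀ x, s₀ (s₂ x) = s₂ (s₀ x)
  ne₀₂ : ∀ x, s₀ (s₂ x) ≠ x
  nonempty : Nonempty Φ
  connected : ∀ x y, Relation.ReflTransGen (fun a b => s₀ a = b ∨ s₁ a = b ∨ s₂ a = b) x y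

namespace SurfaceMap

variable {Φ : Type} (M : SurfaceMap Φ)

/-- The vertices of the map: orbits of flags under `s₁` and `s₂`. -/
def Vertex : Type := Quot (fun x y : Φ => M.s₁ x = y ∨ M.s₂ x = y)

/-- The edges of the map: orbits of flags under `s₀` and `s₂`. -/
def Edge : Type := Quot (fun x y : Φ => M.s₀ x = y ∨ M.s₂ x = y)

/-- The faces of the map: orbits of flags under `s₀` and `s₁`. -/
def Face : Type := Quot (fun x y : Φ => M.s₀ x = y ∨ M.s₁ x = y)

/-- The vertex of a flag. -/
def vertexOf (x : Φ) : M.Vertex := Quot.mk _ x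

/-- The Euler characteristic `|V| - |E| + |F|` of the surface. -/
noncomputable def eulerChar : ℤ :=
  (Nat.card M.Vertex : ℤ) - Nat.card M.Edge + Nat.card M.Face

/-- The Euler genus `2 - χ` of the surface. -/
noncomputable def eulerGenus : ℤ := 2 - M.eulerChar

/-- Two vertices of the map are joined by an edge of the map. -/
def Joined (a b : M.Vertex) : Prop := ∃ x : Φ, M.vertexOf x = a ∧ M.vertexOf (M.s₀ x) = b

end SurfaceMap

/-- `G` is drawn in the surface of `M`: it is a subgraph of the graph of `M`. The map `M` may have
further vertices and edges, so `G` itself need not be connected or cellularly embedded. Every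
embedding of a finite graph in a closed surface extends to such a map. -/
def DrawnIn {V : Type*} (G : SimpleGraph V) {Φ : Type} (M : SurfaceMap Φ) : Prop :=
  ∃ f : V → M.Vertex, Function.Injective f ∧ ∀ v w, G.Adj v w → M.Joined (f v) (f w)

/-- `G` embeds in a closed connected surface of Euler genus at most `k`. -/
def EmbedsInEulerGenus {V : Type*} (G : SimpleGraph V) (k : ℕ) : Prop :=
  ∃ (Φ : Type) (_ : Finite Φ) (M : SurfaceMap Φ), M.eulerGenus ≤ k ∧ DrawnIn G M

/-- The Euler genus of a finite graph: the minimum Euler genus of a closed connected surface in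
which it embeds. -/
noncomputable def eulerGenus {V : Type*} (G : SimpleGraph V) : ℕ :=
  sInf {k | EmbedsInEulerGenus G k}

/-- A `t`-track layout: a proper colouring with `t` colours and a total order on each colour class,
without X-crossings. -/
structure TrackLayout {V : Type*} (G : SimpleGraph V) (t : ℕ) where
  colour : V → Fin t
  proper : ∀ v w, G.Adj v w → colour v ≠ colour w
  order : ∀ i, LinearOrder {v : V // colour v = i}
  no_X_crossing : ∀ i j, i ≠ j → ∀ (v x : {v : V // colour v = i}) (w y : {v : V // colour v = j}),
    G.Adj v w → G.Adj x y → ¬ ((order i).lt v x ∧ (order j).lt y w)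

/-- The track-number: the minimum `t` such that `G` has a `t`-track layout. -/
noncomputable def trackNumber {V : Type*} (G : SimpleGraph V) : ℕ :=
  sInf {t | Nonempty (TrackLayout G t)}

/-- A `k`-queue layout: a linear ordering of the vertices and a partition of the edges into `k`
sets, none of which contains two nested edges. -/
structure QueueLayout {V : Type*} (G : SimpleGraph V) (k : ℕ) where
  order : LinearOrder V
  queue : G.edgeSet → Fin k
  no_nesting : ∀ (v w x y : V) (hvw : G.Adj v w) (hxy : G.Adj x y),
    queue ⟨s(v, w), hvw⟩ = queue ⟨s(x, y), hxy⟩ →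
      ¬ (order.lt v x ∧ order.lt x y ∧ order.lt y w)

/-- The queue-number: the minimum `k` such that `G` has a `k`-queue layout. -/
noncomputable def queueNumber {V : Type*} (G : SimpleGraph V) : ℕ :=
  sInf {k | Nonempty (QueueLayout G k)}

/-! The three minima are over non-empty sets. -/

theorem exists_trackLayout {V : Type*} [Finite V] (G : SimpleGraph V) :
    ∃ t, Nonempty (TrackLayout G t) := by
  obtain ⟨n, ⟨e⟩⟩ := Finite.exists_equiv_fin V
  refine ⟨n, ⟨⟨e, fun v w h he => h.ne (e.injective he),
    fun i => LinearOrder.lift' (fun v => e v.1) (fun a b h => Subtype.ext (e.injective h)), ?_⟩⟩⟩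
  rintro i j - v x w y - - ⟨h, -⟩
  have h' : e v.1 < e x.1 := h
  rw [v.2, x.2] at h'
  exact lt_irrefl _ h'

theorem exists_queueLayout {V : Type*} [Finite V] (G : SimpleGraph V) :
    ∃ k, Nonempty (QueueLayout G k) := by
  obtain ⟨n, ⟨e⟩⟩ := Finite.exists_equiv_fin V
  obtain ⟨k, ⟨q⟩⟩ := Finite.exists_equiv_fin G.edgeSet
  refine ⟨k, ⟨⟨LinearOrder.lift' e e.injective, q, ?_⟩⟩⟩
  rintro v w x y hvw hxy hq ⟨h1, h2, h3⟩
  have h1' : e v < e x := h1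
  have h2' : e x < e y := h2
  have h3' : e y < e w := h3
  have hs : s(v, w) = s(x, y) := congrArg Subtype.val (q.injective hq)
  rcases Sym2.eq_iff.1 hs with ⟨h, -⟩ | ⟨h, -⟩ <;> subst h
  · exact lt_irrefl _ h1'
  · exact lt_irrefl _ (h1'.trans h2')

theorem exists_embedsInEulerGenus {V : Type*} [Finite V] (G : SimpleGraph V) :
    ∃ k, EmbedsInEulerGenus G k := by
  classical
  obtain ⟨n, ⟨e⟩⟩ := Finite.exists_equiv_fin V
  -- The map has vertices `Fin (n + 1)`, one loop at each vertex and two edges between any two.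
  let D : Type := Fin (n + 1) × Bool
  obtain ⟨r, hr, -⟩ := (Finset.univ : Finset D).exists_cycleOn
  have hr1 : ∀ a b : D, ∃ i : ℤ, (r ^ i) a = b := fun a b =>
    hr.2 (Finset.mem_coe.2 (Finset.mem_univ a)) (Finset.mem_coe.2 (Finset.mem_univ b))
  let Φ : Type := Fin (n + 1) × D × Bool
  let s₀ : Φ → Φ := fun x => (x.2.1.1, (x.1, !x.2.1.2), !x.2.2)
  let s₁ : Φ → Φ := fun x =>
    if x.2.2 then (x.1, r x.2.1, false) else (x.1, r.symm x.2.1, true)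
  let s₂ : Φ → Φ := fun x => (x.1, x.2.1, !x.2.2)
  let R : Φ → Φ → Prop := fun a b => s₀ a = b ∨ s₁ a = b ∨ s₂ a = b
  let R' : Φ → Φ → Prop := fun a b => s₁ a = b ∨ s₂ a = b
  -- One step of the rotation, and hence any two flags at the same vertex.
  have step : ∀ (u : Fin (n + 1)) (d : D),
      Relation.ReflTransGen R' (u, d, false) (u, r d, false) := fun u d =>
    (Relation.ReflTransGen.single (r := R') (b := (u, d, true)) (Or.inr rfl)).tail (Or.inl rfl)
  have back : ∀ (u : Fin (n + 1)) (d : D),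
      Relation.ReflTransGen R' (u, d, false) (u, r.symm d, false) := fun u d =>
    (Relation.ReflTransGen.single (r := R') (b := (u, r.symm d, true)) (Or.inl rfl)).tail
      (Or.inr rfl)
  have zrot : ∀ (u : Fin (n + 1)) (d : D) (i : ℤ),
      Relation.ReflTransGen R' (u, d, false) (u, (r ^ i) d, false) := by
    intro u d i
    induction i with
    | zero => exact Relation.ReflTransGen.refl
    | succ i ih =>
      have h : (r ^ ((i : ℤ) + 1)) d = r ((r ^ (i : ℤ)) d) := by
        rw [add_comm (i : ℤ) 1, zpow_add, zpow_one]
        rfl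
      rw [h]
      exact ih.trans (step u _)
    | pred i ih =>
      have h : (r ^ (-(i : ℤ) - 1)) d = r.symm ((r ^ (-(i : ℤ))) d) := by
        rw [sub_eq_add_neg, add_comm (-(i : ℤ)) (-1), zpow_add, zpow_neg_one]
        rfl
      rw [h]
      exact ih.trans (back u _)
  have same : ∀ (u : Fin (n + 1)) (d d' : D) (b b' : Bool),
      Relation.ReflTransGen R' (u, d, b) (u, d', b') := by
    intro u d d' b b'
    have h1 : Relation.ReflTransGen R' (u, d, b) (u, d, false) := by
      cases b
      · exact Relation.ReflTransGen.refl
      · exact Relation.ReflTransGen.single (Or.inr rfl)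
    have h2 : Relation.ReflTransGen R' (u, d', false) (u, d', b') := by
      cases b'
      · exact Relation.ReflTransGen.refl
      · exact Relation.ReflTransGen.single (Or.inr rfl)
    obtain ⟨i, hi⟩ := hr1 d d'
    have h3 := zrot u d i
    rw [hi] at h3
    exact (h1.trans h3).trans h2
  have same' : ∀ (u : Fin (n + 1)) (d d' : D) (b b' : Bool),
      Relation.ReflTransGen R (u, d, b) (u, d', b') := fun u d d' b b' =>
    Relation.ReflTransGen.mono (r := R') (p := R) (fun _ _ h => Or.inr h) _ _ (same u d d' b b')
  let M : SurfaceMap Φ :=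
    { s₀ := s₀
      s₁ := s₁
      s₂ := s₂
      invol₀ := fun x => by simp [s₀]
      invol₁ := by rintro ⟨u, d, _ | _⟩ <;> simp [s₁]
      invol₂ := fun x => by simp [s₂]
      ne₀ := fun x h => by
        have h' := congrArg (fun y : Φ => y.2.2) h
        simp [s₀] at h'
      ne₁ := by
        rintro ⟨u, d, _ | _⟩ h <;>
        · have h' := congrArg (fun y : Φ => y.2.2) h
          simp [s₁] at h'
      ne₂ := fun x h => by
        have h' := congrArg (fun y : Φ => y.2.2) h
        simp [s₂] at h'
      comm₀₂ := fun x => rfl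
      ne₀₂ := fun x h => by
        have h' := congrArg (fun y : Φ => y.2.1.2) h
        simp [s₀, s₂] at h'
      nonempty := ⟨(0, (0, false), false)⟩
      connected := by
        rintro ⟨u, d, b⟩ ⟨u', d', b'⟩
        have h1 := same' u d (u', false) b false
        have h2 : Relation.ReflTransGen R (u, (u', false), false) (u', (u, true), true) :=
          Relation.ReflTransGen.single (Or.inl rfl)
        exact (h1.trans h2).trans (same' u' (u, true) d' true b') }
  have vert : ∀ (u : Fin (n + 1)) (d d' : D) (b b' : Bool),
      M.vertexOf (u, d, b) = M.vertexOf (u, d', b') := by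
    intro u d d' b b'
    have aux : ∀ x y : Φ, Relation.ReflTransGen R' x y → M.vertexOf x = M.vertexOf y := by
      intro x y h
      induction h with
      | refl => rfl
      | tail _ h ih => exact ih.trans (Quot.sound h)
    exact aux _ _ (same u d d' b b')
  let p : M.Vertex → Fin (n + 1) := Quot.lift (fun x : Φ => x.1) (by
    rintro ⟨u, d, b⟩ y (h | h)
    · rw [← h]
      cases b <;> rfl
    · rw [← h])
  refine ⟨M.eulerGenus.toNat, Φ, inferInstance, M, Int.self_le_toNat _,
    fun v => M.vertexOf ((e v).castSucc, (0, false), false), ?_, ?_⟩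
  · intro v w h
    have h' := congrArg p h
    exact e.injective (Fin.castSucc_injective n h')
  · intro v w _
    exact ⟨((e v).castSucc, ((e w).castSucc, false), false), vert _ _ _ _ _, vert _ _ _ _ _⟩

end GraphLayout

/-! Queues come from tracks by placing the tracks one after another and sorting the edges by the
distance between their tracks. Two nested edges at the same distance would join the same two tracks
and form an X-crossing, so `t` tracks give `t - 1` queues.

For the upper bound, a stellar subdivision makes all faces triangles without changing the genus. Let
`T` be a breadth-first search tree of the vertices and `C` a spanning tree of the dual that crosses
no edge of `T`. By Euler's formula at most `g` edges lie in neither tree (`card_rest_le`). Call a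
path of `T` towards the root vertical; it has one vertex at each depth.

The vertices above an end of a leftover edge lie on at most `2g` vertical paths. For any other
vertex `v`, every edge at the subtree of `T` below `v` is in `T` or `C`. Walking around that subtree
therefore shows that the faces touching it are connected in `C` (`conn_faces`). Adjacent vertices
get intersecting subtrees of `C`.

Subtrees of a tree have balanced separators: some node leaves branches with at most half of the
family each (`exists_separator`). Iteration gives a separation tree with fewer than `2 ^ k` members
distributed over `k` levels, where intersecting members sit at comparable nodes
(`exists_hierarchy`). The members at one node share a face, so they lie on the three vertical paths
from its corners.

This gives at most `2g + 3k` labels: a leftover end, or a level with a corner. Depth, position in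
the separation tree and label determine a vertex, and edges between two labels are monotone in the
position. Depth modulo 3 triples the labels into `6g + 9k` tracks
(`nonempty_trackLayout_of_layering`). -/

namespace GraphLayout

/-! ### Queue layouts from track layouts -/

namespace TrackLayout

variable {V : Type*} {G : SimpleGraph V} {t : ℕ} (L : TrackLayout G t)

/-- The vertices ordered by track, and within each track by the order of the track. -/
@[reducible]
noncomputable def vertexOrder : LinearOrder V :=
  letI := L.order
  LinearOrder.lift' (β := Σₗ i : Fin t, {v : V // L.colour v = i})
    (fun v => toLex ⟨L.colour v, ⟨v, rfl⟩⟩)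
    (fun a b h => by
      have h' := congrArg (fun z : (Σₗ i : Fin t, {v : V // L.colour v = i}) =>
        ((ofLex z).2 : V)) h
      exact h')

theorem vertexOrder_lt_iff (v w : V) : L.vertexOrder.lt v w ↔ L.colour v < L.colour w ∨
    ∃ h : L.colour v = L.colour w, (L.order (L.colour w)).lt ⟨v, h⟩ ⟨w, rfl⟩ := by
  let := L.order
  have : L.vertexOrder.lt v w ↔ Sigma.Lex (· < ·) (fun i => (L.order i).lt)
    (⟨L.colour v, ⟨v, rfl⟩⟩ : Σ i : Fin t, {v : V // L.colour v = i}) ⟨L.colour w, ⟨w, rfl⟩⟩ :=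
    Iff.rfl
  rw [this, Sigma.lex_iff]
  -- `Sigma.lex_iff` transports the second component along the equality of colours; this removes the
  -- cast.
  have key : ∀ (j : Fin t) (h : L.colour v = j),
      (h ▸ (⟨v, rfl⟩ : {u : V // L.colour u = L.colour v}) : {u : V // L.colour u = j}) =
        ⟨v, h⟩ := by
    rintro _ rfl; rfl
  constructor
  · rintro (h | ⟨h, h'⟩)
    · exact Or.inl h
    · refine Or.inr ⟨h, ?_⟩
      have := key _ h
      simp only at h'
      rw [this] at h'
      exact h'
  · rintro (h | ⟨h, h'⟩)
    · exact Or.inl h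
    · refine Or.inr ⟨h, ?_⟩
      have := key _ h
      simp only
      rw [this]
      exact h'

/-- The distance between the tracks of the two ends of an edge. -/
def span (e : Sym2 V) : ℕ :=
  Sym2.lift ⟨fun v w => Nat.dist (L.colour v) (L.colour w), fun _ _ => Nat.dist_comm _ _⟩ e

theorem span_mk (v w : V) : L.span s(v, w) = Nat.dist (L.colour v) (L.colour w) := rfl

theorem span_pos {e : Sym2 V} (he : e ∈ G.edgeSet) : 0 < L.span e := by
  induction e with | _ v w
  rw [span_mk]
  refine Nat.dist_pos_of_ne fun h => L.proper v w he (Fin.ext h)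

theorem span_lt {e : Sym2 V} (he : e ∈ G.edgeSet) : L.span e - 1 < t - 1 := by
  have h := L.span_pos he
  induction e with | _ v w
  rw [span_mk] at *
  have h1 := (L.colour v).2
  have h2 := (L.colour w).2
  unfold Nat.dist at *
  omega

/-- A `t`-track layout gives a `(t - 1)`-queue layout. -/
theorem nonempty_queueLayout (L : TrackLayout G t) : Nonempty (QueueLayout G (t - 1)) := by
  refine ⟨⟨L.vertexOrder, fun e => ⟨L.span e.1 - 1, L.span_lt e.2⟩, ?_⟩⟩
  rintro v w x y hvw hxy hq ⟨h1, h2, h3⟩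
  have hs := congrArg Fin.val hq
  have p1 := L.span_pos (e := s(v, w)) hvw
  have p2 := L.span_pos (e := s(x, y)) hxy
  simp only [span_mk] at hs p1 p2
  rw [vertexOrder_lt_iff] at h1 h2 h3
  have le : ∀ {a b : V}, (L.colour a < L.colour b ∨
      ∃ h : L.colour a = L.colour b, (L.order (L.colour b)).lt ⟨a, h⟩ ⟨b, rfl⟩) →
      (L.colour a : ℕ) ≤ L.colour b := by
    rintro a b (h | ⟨h, -⟩)
    · exact h.le
    · exact (congrArg Fin.val h).le
  have c1 := le h1
  have c2 := le h2
  have c3 := le h3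
  unfold Nat.dist at hs p1 p2
  -- The tracks satisfy `v ≤ x ≤ y ≤ w`, so equal spans force both ends into common tracks.
  -- Positivity of the spans undoes the truncated `- 1`.
  have e1 : L.colour v = L.colour x := Fin.ext (by omega)
  have e2 : L.colour y = L.colour w := Fin.ext (by omega)
  have h1' := h1.resolve_left (by rw [e1]; exact lt_irrefl _)
  have h3' := h3.resolve_left (by rw [e2]; exact lt_irrefl _)
  obtain ⟨_, h1'⟩ := h1'
  obtain ⟨_, h3'⟩ := h3'
  exact L.no_X_crossing (L.colour x) (L.colour w) (fun h => L.proper v w hvw (e1.trans h))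
    ⟨v, e1⟩ ⟨x, rfl⟩ ⟨w, rfl⟩ ⟨y, e2⟩ hvw hxy ⟨h1', h3'⟩

end TrackLayout

theorem queueNumber_lt_trackNumber {V : Type*} [Finite V] [Nonempty V] (G : SimpleGraph V) :
    queueNumber G < trackNumber G := by
  obtain ⟨L⟩ : Nonempty (TrackLayout G (trackNumber G)) := Nat.sInf_mem (exists_trackLayout G)
  have h : queueNumber G ≤ trackNumber G - 1 := Nat.sInf_le L.nonempty_queueLayout
  -- A vertex needs a colour, so there is at least one track and the truncated subtraction is
  -- strict.
  have := (L.colour (Classical.arbitrary V)).2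
  omega

/-! ### Track layouts from layerings -/

/-- A layering `l`, refined by labels `c` and positions `p` such that the edges between any two
labels are monotone in the position, gives a track layout with three tracks for each label. -/
theorem nonempty_trackLayout_of_layering {V κ P : Type*} [Fintype κ] [LinearOrder P]
    (G : SimpleGraph V) (l : V → ℕ) (c : V → κ) (p : V → P)
    (layer : ∀ v w, G.Adj v w → l v ≤ l w + 1)
    (inj : ∀ v w, c v = c w → l v = l w → p v = p w → v = w)
    (adj : ∀ v w, G.Adj v w → c v = c w → p v = p w)
    (mono : ∀ v w x y, G.Adj v w → G.Adj x y → c v = c x → c w = c y → p v < p x → p w ≤ p y) :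
    Nonempty (TrackLayout G (3 * Fintype.card κ)) := by
  classical
  let e : Fin 3 × κ ≃ Fin (3 * Fintype.card κ) :=
    Fintype.equivFinOfCardEq (by simp)
  let col : V → Fin 3 × κ := fun v => (⟨l v % 3, Nat.mod_lt _ (by norm_num)⟩, c v)
  have hcol : ∀ v w, e (col v) = e (col w) → l v % 3 = l w % 3 ∧ c v = c w := by
    intro v w h
    have h' := e.injective h
    exact ⟨congrArg (fun z => (z.1 : ℕ)) h', congrArg Prod.snd h'⟩
  have key_inj : ∀ i, Function.Injective
      (fun v : {v : V // e (col v) = i} => (toLex (l v.1, p v.1) : ℕ ×ₗ P)) := by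
    rintro i ⟨v, hv⟩ ⟨w, hw⟩ h
    have h1 : (l v, p v) = (l w, p w) := h
    rw [Prod.mk.injEq] at h1
    exact Subtype.ext (inj v w (hcol v w (hv.trans hw.symm)).2 h1.1 h1.2)
  refine ⟨⟨fun v => e (col v), ?_, fun i => LinearOrder.lift' _ (key_inj i), ?_⟩⟩
  · intro v w h he
    obtain ⟨h1, h2⟩ := hcol v w he
    have := layer v w h
    have := layer w v h.symm
    exact h.ne (inj v w h2 (by omega) (adj v w h h2))
  · rintro i j - ⟨v, hv⟩ ⟨x, hx⟩ ⟨w, hw⟩ ⟨y, hy⟩ (hvw : G.Adj v w) (hxy : G.Adj x y) ⟨h1, h2⟩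
    have h1' : (toLex (l v, p v) : ℕ ×ₗ P) < toLex (l x, p x) := h1
    have h2' : (toLex (l y, p y) : ℕ ×ₗ P) < toLex (l w, p w) := h2
    rw [Prod.Lex.toLex_lt_toLex] at h1' h2'
    obtain ⟨m1, c1⟩ := hcol v x (hv.trans hx.symm)
    obtain ⟨m2, c2⟩ := hcol w y (hw.trans hy.symm)
    have a1 := layer v w hvw
    have a2 := layer w v hvw.symm
    have a3 := layer x y hxy
    have a4 := layer y x hxy.symm
    simp only at h1' h2'
    -- Layers on one track agree modulo 3. If `l v < l x`, the gap is at least 3, and as edges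
    -- change the layer by at most 1, `l w < l y`, against the order of `y` and `w`.
    have e1 : l v = l x := by
      rcases h1' with h | h <;> rcases h2' with h' | h' <;> omega
    have e2 : l y = l w := by
      rcases h1' with h | h <;> rcases h2' with h' | h' <;> omega
    have q1 : p v < p x := (h1'.resolve_left (by omega)).2
    have q2 : p y < p w := (h2'.resolve_left (by omega)).2
    exact absurd (mono v w x y hvw hxy c1 c2 q1) (not_le.2 q2)

/-! ### Rooted trees -/

/-- A rooted spanning tree on `A`, given by its parent function and its depth function. -/
structure RTree (A : Type*) where
  root : A
  par : A → A
  depth : A → ℕ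
  par_root : par root = root
  depth_root : depth root = 0
  depth_par : ∀ a, a ≠ root → depth (par a) + 1 = depth a

namespace RTree

variable {A : Type*} (T : RTree A)

/-- `T.Anc a b`: the node `a` is an ancestor of `b`, or `b` itself. -/
def Anc (a b : A) : Prop := ∃ k, T.par^[k] b = a

theorem Anc.refl (a : A) : T.Anc a a := ⟨0, rfl⟩

variable {T}

theorem Anc.trans {a b c : A} (h : T.Anc a b) (h' : T.Anc b c) : T.Anc a c := by
  obtain ⟨k, rfl⟩ := h
  obtain ⟨m, rfl⟩ := h'
  exact ⟨k + m, Function.iterate_add_apply ..⟩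

variable (T)

theorem anc_par (a : A) : T.Anc (T.par a) a := ⟨1, rfl⟩

theorem depth_eq_zero {a : A} : T.depth a = 0 ↔ a = T.root := by
  constructor
  · intro h
    by_contra ha
    have := T.depth_par a ha
    omega
  · rintro rfl; exact T.depth_root

theorem depth_par_eq (a : A) : T.depth (T.par a) = T.depth a - 1 := by
  by_cases h : a = T.root
  · rw [h, T.par_root, T.depth_root]
  · have := T.depth_par a h
    omega

theorem depth_iterate (k : ℕ) (a : A) : T.depth (T.par^[k] a) = T.depth a - k := by
  induction k with
  | zero => rfl
  | succ k ih => rw [Function.iterate_succ_apply', depth_par_eq, ih]; omega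

theorem root_anc (a : A) : T.Anc T.root a :=
  ⟨T.depth a, by rw [← depth_eq_zero, depth_iterate, Nat.sub_self]⟩

variable {T}

/-- The ancestors of `c` are the iterates of `par`, along which the depth drops by one until it
stays at the root. This is why label and layer leave little ambiguity in a track. -/
theorem Anc.eq_of_depth_eq {a b c : A} (ha : T.Anc a c) (hb : T.Anc b c)
    (h : T.depth a = T.depth b) : a = b := by
  obtain ⟨k, rfl⟩ := ha
  obtain ⟨m, rfl⟩ := hb
  by_cases h0 : T.depth (T.par^[k] c) = 0
  · exact (T.depth_eq_zero.1 h0).trans (T.depth_eq_zero.1 (h ▸ h0)).symm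
  · rw [T.depth_iterate] at h h0
    rw [T.depth_iterate] at h
    have : k = m := by omega
    rw [this]

theorem Anc.eq_or_par {a b : A} (h : T.Anc a b) : a = b ∨ T.Anc a (T.par b) := by
  obtain ⟨_ | k, rfl⟩ := h
  · exact Or.inl rfl
  · exact Or.inr ⟨k, rfl⟩

/-- A proper descendant lies below a child. -/
theorem Anc.exists_child {a b : A} (h : T.Anc a b) (hne : a ≠ b) :
    ∃ c, c ≠ T.root ∧ T.par c = a ∧ T.Anc c b := by
  obtain ⟨k, hk⟩ := h
  induction k generalizing b with
  | zero => exact absurd hk.symm hne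
  | succ k ih =>
    rw [Function.iterate_succ_apply] at hk
    by_cases hp : a = T.par b
    · refine ⟨b, ?_, hp.symm, Anc.refl T b⟩
      rintro rfl
      exact hne (hp.trans T.par_root)
    · obtain ⟨c, hc, hca, hcb⟩ := ih hp hk
      exact ⟨c, hc, hca, hcb.trans (T.anc_par b)⟩

variable (T)

/-- A set of nodes that is connected in the tree. -/
def Conn (S : Set A) : Prop :=
  ∀ a ∈ S, ∀ b ∈ S,
    Relation.ReflTransGen (fun x y => x ∈ S ∧ y ∈ S ∧ (T.par x = y ∨ T.par y = x)) a b

variable {T}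

/-- A connected set that avoids the parent of `c` and meets the subtree below `c` lies in it. -/
theorem Conn.anc_of_anc {S : Set A} (hS : T.Conn S) {c a b : A} (hf : T.par c ∉ S)
    (ha : a ∈ S) (hb : b ∈ S) (hca : T.Anc c a) : T.Anc c b := by
  have h := hS a ha b hb
  clear hb
  induction h with
  | refl => exact hca
  | tail _ h ih =>
    -- The only step out of the subtree below `c` goes from `c` to its parent, which is not in `S`.
    obtain ⟨_, h2, h3 | h3⟩ := h
    · rcases ih.eq_or_par with h4 | h4
      · rw [← h4] at h3
        exact absurd (h3 ▸ h2) hf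
      · exact h3 ▸ h4
    · exact ih.trans (h3 ▸ T.anc_par _)

/-! ### Balanced separation of subtrees of a tree -/

/-- A family of connected subtrees has a node such that, among the subtrees avoiding it, those on
each of its branches make up at most half of the family. -/
theorem exists_separator [Finite A] (T : RTree A) {V : Type*} (B : V → Set A)
    (hB : ∀ v, T.Conn (B v)) (hne : ∀ v, (B v).Nonempty) (W : Finset V) (hW : W.Nonempty) :
    ∃ f : A, ∃ γ : V → A,
      (∀ v w, f ∉ B v → f ∉ B w → (B v ∩ B w).Nonempty → γ v = γ w) ∧
      ∀ j, ∀ U ⊆ W, (∀ v ∈ U, f ∉ B v ∧ γ v = j) → 2 * U.card ≤ W.card := by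
  classical
  let S : A → Finset V := fun f => W.filter (fun v => ∀ a ∈ B v, T.Anc f a)
  -- The separator is a deepest node with more than half of the family entirely below it; the root
  -- qualifies.
  obtain ⟨f, hf, hmax⟩ := Set.exists_max_image {f | W.card < 2 * (S f).card} T.depth
    (Set.toFinite _) ⟨T.root, by
      have : S T.root = W := Finset.filter_true_of_mem fun v _ a _ => T.root_anc a
      have := hW.card_pos
      change W.card < 2 * (S T.root).card
      rw [‹S T.root = W›]
      omega⟩
  have hchild : ∀ v, f ∉ B v → ∀ a ∈ B v, T.Anc f a →
      ∃ c, c ≠ T.root ∧ T.par c = f ∧ ∀ b ∈ B v, T.Anc c b := by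
    intro v hv a ha hfa
    obtain ⟨c, hc, rfl, hca⟩ := hfa.exists_child (fun h => hv (h ▸ ha))
    exact ⟨c, hc, rfl, fun b hb => (hB v).anc_of_anc hv ha hb hca⟩
  -- Branches are named by the children of `f`; the value `f` itself names the part that is not
  -- below `f`.
  let γ : V → A := fun v => if h : ∃ c, c ≠ T.root ∧ T.par c = f ∧ ∀ b ∈ B v, T.Anc c b
    then h.choose else f
  have hγ : ∀ v, f ∉ B v → ∀ a ∈ B v, T.Anc f a →
      γ v ≠ T.root ∧ T.par (γ v) = f ∧ ∀ b ∈ B v, T.Anc (γ v) b := by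
    intro v hv a ha hfa
    have h := hchild v hv a ha hfa
    simp only [γ, dif_pos h]
    exact h.choose_spec
  have hγ' : ∀ v, (∀ a ∈ B v, ¬ T.Anc f a) → γ v = f := by
    intro v hv
    refine dif_neg ?_
    rintro ⟨c, -, rfl, hc⟩
    obtain ⟨a, ha⟩ := hne v
    exact hv a ha ((T.anc_par c).trans (hc a ha))
  have hor : ∀ v, f ∉ B v →
      (γ v ≠ T.root ∧ T.par (γ v) = f ∧ ∀ b ∈ B v, T.Anc (γ v) b) ∨
        (γ v = f ∧ ∀ a ∈ B v, ¬ T.Anc f a) := by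
    intro v hv
    by_cases h : ∃ a ∈ B v, T.Anc f a
    · obtain ⟨a, ha, hfa⟩ := h
      exact Or.inl (hγ v hv a ha hfa)
    · push Not at h
      exact Or.inr ⟨hγ' v h, h⟩
  refine ⟨f, γ, ?_, ?_⟩
  · rintro v w hv hw ⟨a, hav, haw⟩
    rcases hor v hv with ⟨h1, h2, h3⟩ | ⟨h1, h2⟩ <;> rcases hor w hw with ⟨k1, k2, k3⟩ | ⟨k1, k2⟩
    · refine (h3 a hav).eq_of_depth_eq (k3 a haw) ?_
      have e1 := T.depth_par _ h1
      have e2 := T.depth_par _ k1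
      rw [h2] at e1
      rw [k2] at e2
      exact e1.symm.trans e2
    · exact absurd (h2 ▸ (T.anc_par _).trans (h3 a hav)) (k2 a haw)
    · exact absurd (k2 ▸ (T.anc_par _).trans (k3 a haw)) (h2 a hav)
    · exact h1.trans k1.symm
  · intro j U hU hUj
    -- A branch below a child has at most half of the family since `f` is deepest; the remaining
    -- branch is disjoint from `S f`, which has more than half.
    by_cases hex : ∃ v ∈ U, ∃ a ∈ B v, T.Anc f a
    · obtain ⟨v, hvU, a, ha, hfa⟩ := hex
      obtain ⟨h1, h2, -⟩ := hγ v (hUj v hvU).1 a ha hfa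
      rw [(hUj v hvU).2] at h1 h2
      have hdep : T.depth f + 1 = T.depth j := by
        rw [← h2]; exact T.depth_par _ h1
      have hsub : U ⊆ S j := by
        intro w hw
        refine Finset.mem_filter.2 ⟨hU hw, ?_⟩
        rcases hor w (hUj w hw).1 with ⟨-, -, k3⟩ | ⟨k1, -⟩
        · rw [(hUj w hw).2] at k3
          exact k3
        · rw [(hUj w hw).2] at k1
          rw [k1] at hdep
          omega
      have := Finset.card_le_card hsub
      have hj : ¬ W.card < 2 * (S j).card := fun h => by
        have := hmax j h
        omega
      omega
    · push Not at hex
      have hdisj : Disjoint U (S f) := by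
        rw [Finset.disjoint_left]
        intro v hv hv'
        obtain ⟨a, ha⟩ := hne v
        exact hex v hv a ha ((Finset.mem_filter.1 hv').2 a ha)
      have h1 : U.card + (S f).card ≤ W.card := by
        rw [← Finset.card_union_of_disjoint hdisj]
        exact Finset.card_le_card (Finset.union_subset hU (Finset.filter_subset _ _))
      have hf' : W.card < 2 * (S f).card := hf
      omega

/-- Recursive separation of a family of fewer than `2 ^ k` subtrees: `p v` is the node of the
separation tree that contains `v`. -/
theorem exists_hierarchy [Finite A] (T : RTree A) {V : Type*} (B : V → Set A)
    (hB : ∀ v, T.Conn (B v)) (hne : ∀ v, (B v).Nonempty) (k : ℕ) (W : Finset V)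
    (hW : W.card < 2 ^ k) :
    ∃ p : V → List ℕ, (∀ v ∈ W, (p v).length < k) ∧
      (∀ v ∈ W, ∀ w ∈ W, (B v ∩ B w).Nonempty → (p v).length = (p w).length → p v = p w) ∧
      (∀ v ∈ W, ∀ w ∈ W, ∀ x ∈ W, ∀ y ∈ W, (B v ∩ B w).Nonempty → (B x ∩ B y).Nonempty →
        (p v).length = (p x).length → (p w).length = (p y).length → p v < p x → p w ≤ p y) ∧
      ∀ l, ∃ f, ∀ v ∈ W, p v = l → f ∈ B v := by
  classical
  induction k generalizing W with
  | zero =>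
    have : W = ∅ := by rwa [pow_zero, Nat.lt_one_iff, Finset.card_eq_zero] at hW
    subst this
    exact ⟨fun _ => [], by simp, by simp, by simp, fun _ => ⟨T.root, by simp⟩⟩
  | succ k ih =>
    rcases W.eq_empty_or_nonempty with rfl | hW0
    · exact ⟨fun _ => [], by simp, by simp, by simp, fun _ => ⟨T.root, by simp⟩⟩
    obtain ⟨f, γ, hγ, hcard⟩ := T.exists_separator B hB hne W hW0
    obtain ⟨m, ⟨e⟩⟩ := Finite.exists_equiv_fin A
    let U : A → Finset V := fun j => W.filter (fun v => f ∉ B v ∧ γ v = j)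
    have hU : ∀ j, (U j).card < 2 ^ k := by
      intro j
      have := hcard j (U j) (Finset.filter_subset _ _) (fun v hv => (Finset.mem_filter.1 hv).2)
      rw [pow_succ] at hW
      omega
    choose p h1 h2 h3 h4 using fun j => ih (U j) (hU j)
    -- A position is the address in the separation tree: empty at the separator, otherwise the
    -- branch followed by the address within it.
    let q : V → List ℕ := fun v => if f ∈ B v then [] else (e (γ v) : ℕ) :: p (γ v) v
    have q0 : ∀ v, f ∈ B v → q v = [] := fun v hv => if_pos hv
    have q1 : ∀ v, f ∉ B v → q v = (e (γ v) : ℕ) :: p (γ v) v := fun v hv => if_neg hv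
    have mem : ∀ v ∈ W, f ∉ B v → v ∈ U (γ v) := fun v hv hf =>
      Finset.mem_filter.2 ⟨hv, hf, rfl⟩
    refine ⟨q, ?_, ?_, ?_, ?_⟩
    · intro v hv
      by_cases hf : f ∈ B v
      · rw [q0 v hf]; simp
      · rw [q1 v hf, List.length_cons]
        exact Nat.succ_lt_succ (h1 _ v (mem v hv hf))
    · intro v hv w hw hvw hl
      by_cases hfv : f ∈ B v <;> by_cases hfw : f ∈ B w
      · rw [q0 v hfv, q0 w hfw]
      · rw [q0 v hfv, q1 w hfw] at hl; simp at hl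
      · rw [q1 v hfv, q0 w hfw] at hl; simp at hl
      · rw [q1 v hfv, q1 w hfw, List.length_cons, List.length_cons] at hl
        have hg := hγ v w hfv hfw hvw
        have mv := mem v hv hfv
        have mw := mem w hw hfw
        rw [q1 v hfv, q1 w hfw]
        rw [← hg] at mw hl ⊢
        rw [h2 _ v mv w mw hvw (by omega)]
    · intro v hv w hw x hx y hy hvw hxy hl hl' hlt
      by_cases hfv : f ∈ B v
      · by_cases hfx : f ∈ B x
        · rw [q0 v hfv, q0 x hfx] at hlt; exact absurd hlt (lt_irrefl _)
        · rw [q0 v hfv, q1 x hfx] at hl; simp at hl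
      by_cases hfx : f ∈ B x
      · rw [q1 v hfv, q0 x hfx] at hl; simp at hl
      by_cases hfw : f ∈ B w
      · by_cases hfy : f ∈ B y
        · rw [q0 w hfw, q0 y hfy]
        · rw [q0 w hfw, q1 y hfy] at hl'; simp at hl'
      by_cases hfy : f ∈ B y
      · rw [q1 w hfw, q0 y hfy] at hl'; simp at hl'
      rw [q1 v hfv, q1 x hfx] at hl hlt
      rw [q1 w hfw, q1 y hfy] at hl' ⊢
      simp only [List.length_cons, add_left_inj] at hl hl'
      have g1 := hγ v w hfv hfw hvw
      have g2 := hγ x y hfx hfy hxy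
      have mv := mem v hv hfv
      have mw := mem w hw hfw
      have mx := mem x hx hfx
      have my := mem y hy hfy
      rw [← g1] at mw hl' ⊢
      rw [← g2] at my hl' ⊢
      rw [List.cons_lt_cons_iff] at hlt
      rw [← not_lt, List.cons_lt_cons_iff]
      -- Intersecting subtrees share a branch. Distinct first letters thus decide both comparisons
      -- alike; equal ones put all four in one branch, where induction applies.
      rcases hlt with h | ⟨h, h'⟩
      · omega
      · have g : γ v = γ x := e.injective (Fin.ext h)
        rw [← g] at mx my hl hl' h' ⊢
        have := h3 _ v mv w mw x mx y my hvw hxy hl hl' h'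
        rintro (h'' | ⟨-, h''⟩)
        · exact lt_irrefl _ h''
        · exact absurd h'' (not_lt.2 this)
    · rintro (_ | ⟨i, l⟩)
      · refine ⟨f, fun v hv hl => ?_⟩
        by_contra hf
        rw [q1 v hf] at hl
        simp at hl
      · by_cases hi : ∃ j, (e j : ℕ) = i
        · obtain ⟨j, rfl⟩ := hi
          obtain ⟨g, hg⟩ := h4 j l
          refine ⟨g, fun v hv hl => ?_⟩
          by_cases hf : f ∈ B v
          · rw [q0 v hf] at hl; simp at hl
          · rw [q1 v hf, List.cons.injEq] at hl
            have hj : γ v = j := e.injective (Fin.ext hl.1)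
            have mv := mem v hv hf
            rw [hj] at mv hl
            exact hg v mv hl.2
        -- No position starts with this letter, so any node will do.
        · refine ⟨T.root, fun v hv hl => ?_⟩
          by_cases hf : f ∈ B v
          · rw [q0 v hf] at hl; simp at hl
          · rw [q1 v hf, List.cons.injEq] at hl
            exact absurd ⟨_, hl.1⟩ hi

end RTree

/-- Breadth-first search trees. The edges are the pairs `π x`, `π (σ x)` with `x ∈ K`; the edge
from a node `a` to its parent is the one of `up a`. -/
theorem exists_bfsTree {Φ A : Type*} [Nonempty Φ] (π : Φ → A) (σ : Φ → Φ) (K : Set Φ)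
    (hσ : ∀ x, σ (σ x) = x) (hK : ∀ x ∈ K, σ x ∈ K) (r : A)
    (hconn : ∀ a, Relation.ReflTransGen (fun a b => ∃ x ∈ K, π x = a ∧ π (σ x) = b) a r) :
    ∃ (T : RTree A) (up : A → Φ),
      (∀ a, a ≠ T.root → up a ∈ K ∧ π (up a) = a ∧ π (σ (up a)) = T.par a) ∧
      ∀ x ∈ K, T.depth (π x) ≤ T.depth (π (σ x)) + 1 := by
  classical
  let H : SimpleGraph A :=
    { Adj := fun a b => a ≠ b ∧ ∃ x ∈ K, π x = a ∧ π (σ x) = b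
      symm := ⟨by
        rintro a b ⟨hne, x, hx, rfl, rfl⟩
        exact ⟨hne.symm, σ x, hK x hx, rfl, by rw [hσ]⟩⟩
      loopless := ⟨fun a h => h.1 rfl⟩ }
  have hreach : ∀ a, H.Reachable a r := by
    intro a
    have h := hconn a
    induction h using Relation.ReflTransGen.head_induction_on with
    | refl => exact SimpleGraph.Reachable.refl _
    | @head a b h _ ih =>
      by_cases hab : a = b
      · rw [hab]; exact ih
      · exact (SimpleGraph.Adj.reachable (G := H) ⟨hab, h⟩).trans ih
  have hH : H.Connected := by
    have : Nonempty A := ⟨r⟩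
    exact ⟨fun a b => (hreach a).trans (hreach b).symm⟩
  -- The second vertex of a shortest walk to `r` can serve as the parent.
  have hstep : ∀ a, a ≠ r → ∃ b, H.Adj a b ∧ H.dist b r + 1 = H.dist a r := by
    intro a ha
    obtain ⟨w, hw⟩ := (hreach a).exists_walk_length_eq_dist
    cases w with
    | nil => exact absurd rfl ha
    | @cons _ b _ hab w' =>
      refine ⟨b, hab, ?_⟩
      rw [SimpleGraph.Walk.length_cons] at hw
      have h1 := SimpleGraph.dist_le w'
      have h2 : H.dist a r ≤ H.dist a b + H.dist b r := hH.dist_triangle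
      rw [SimpleGraph.dist_eq_one_iff_adj.2 hab] at h2
      omega
  have hx0 : ∀ a, a ≠ r → ∃ x ∈ K, π x = a ∧ H.dist (π (σ x)) r + 1 = H.dist a r := by
    intro a ha
    obtain ⟨b, ⟨_, x, hx, hxa, rfl⟩, hb⟩ := hstep a ha
    exact ⟨x, hx, hxa, hb⟩
  choose! up hup using hx0
  refine ⟨⟨r, fun a => if a = r then r else π (σ (up a)), fun a => H.dist a r, if_pos rfl,
    SimpleGraph.dist_self, fun a ha => ?_⟩, up, fun a ha => ?_, fun x hx => ?_⟩
  · rw [if_neg ha]; exact (hup a ha).2.2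
  · exact ⟨(hup a ha).1, (hup a ha).2.1, (if_neg ha).symm⟩
  · by_cases hne : π x = π (σ x)
    · simp only; rw [← hne]; omega
    · have h2 : H.dist (π x) r ≤ H.dist (π x) (π (σ x)) + H.dist (π (σ x)) r := hH.dist_triangle
      have hadj : H.Adj (π x) (π (σ x)) := ⟨hne, x, hx, rfl, rfl⟩
      rw [SimpleGraph.dist_eq_one_iff_adj.2 hadj] at h2
      simp only
      omega

/-! ### Orbits of flags -/

/-- An invariant predicate descends to the quotient, so orbits can be handled without describing the
generated equivalence relation. -/
theorem iff_of_quot_mk_eq {α : Type*} {r : α → α → Prop} (S : α → Prop)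
    (hS : ∀ a b, r a b → (S a ↔ S b)) {a b : α} (h : Quot.mk r a = Quot.mk r b) : S a ↔ S b :=
  iff_of_eq (congrArg (Quot.lift S fun a b hab => propext (hS a b hab)) h)

theorem quot_mk_eq_iff_of_involutive {α : Type*} (s : α → α) (hs : ∀ x, s (s x) = x) {x y : α} :
    Quot.mk (fun x y => s x = y) y = Quot.mk (fun x y => s x = y) x ↔ y = x ∨ y = s x := by
  constructor
  · intro h
    refine (iff_of_quot_mk_eq (fun y => y = x ∨ y = s x) ?_ h).2 (Or.inl rfl)
    rintro a _ rfl
    constructor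
    · rintro (rfl | rfl)
      · exact Or.inr rfl
      · exact Or.inl (hs _)
    · rintro (h | h)
      · exact Or.inr (by rw [← h, hs])
      · exact Or.inl (by rw [← hs a, h, hs])
  · rintro (rfl | rfl)
    · rfl
    · symm
      apply Quot.sound
      rfl

theorem two_mul_card_quot_involutive {α : Type*} [Finite α] (s : α → α) (hs : ∀ x, s (s x) = x)
    (hne : ∀ x, s x ≠ x) : 2 * Nat.card (Quot fun x y => s x = y) = Nat.card α := by
  classical
  have := Fintype.ofFinite α
  have hfin : Finite (Quot fun x y => s x = y) := Quot.finite _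
  have := Fintype.ofFinite (Quot fun x y => s x = y)
  rw [Nat.card_eq_fintype_card, Nat.card_eq_fintype_card, ← Finset.card_univ (α := α),
    Finset.card_eq_sum_card_fiberwise (f := Quot.mk fun x y => s x = y) (t := Finset.univ)
      (fun _ _ => Finset.mem_coe.2 (Finset.mem_univ _))]
  rw [Finset.sum_congr rfl (g := fun _ => 2), Finset.sum_const, Finset.card_univ, smul_eq_mul,
    mul_comm]
  intro q _
  induction q using Quot.ind with | _ x
  have : (Finset.univ.filter fun y => Quot.mk (fun x y => s x = y) y =
      Quot.mk (fun x y => s x = y) x) = {x, s x} := by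
    ext y
    simp [quot_mk_eq_iff_of_involutive s hs]
  rw [this, Finset.card_pair (hne x).symm]

namespace SurfaceMap

variable {Φ : Type} (M : SurfaceMap Φ)

/-- The edge of a flag. -/
def edgeOf (x : Φ) : M.Edge := Quot.mk _ x

/-- The face of a flag. -/
def faceOf (x : Φ) : M.Face := Quot.mk _ x

@[simp] theorem vertexOf_s₁ (x : Φ) : M.vertexOf (M.s₁ x) = M.vertexOf x := by
  symm; apply Quot.sound; exact Or.inl rfl
@[simp] theorem vertexOf_s₂ (x : Φ) : M.vertexOf (M.s₂ x) = M.vertexOf x := by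
  symm; apply Quot.sound; exact Or.inr rfl
@[simp] theorem edgeOf_s₀ (x : Φ) : M.edgeOf (M.s₀ x) = M.edgeOf x := by
  symm; apply Quot.sound; exact Or.inl rfl
@[simp] theorem edgeOf_s₂ (x : Φ) : M.edgeOf (M.s₂ x) = M.edgeOf x := by
  symm; apply Quot.sound; exact Or.inr rfl
@[simp] theorem faceOf_s₀ (x : Φ) : M.faceOf (M.s₀ x) = M.faceOf x := by
  symm; apply Quot.sound; exact Or.inl rfl
@[simp] theorem faceOf_s₁ (x : Φ) : M.faceOf (M.s₁ x) = M.faceOf x := by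
  symm; apply Quot.sound; exact Or.inr rfl

instance [Finite Φ] : Finite M.Vertex := Quot.finite _
instance [Finite Φ] : Finite M.Edge := Quot.finite _
instance [Finite Φ] : Finite M.Face := Quot.finite _

/-- `s₀` and `s₂` are commuting involutions, so these four flags are closed under both. -/
theorem edgeOf_eq_iff {x y : Φ} : M.edgeOf x = M.edgeOf y ↔
    x = y ∨ x = M.s₀ y ∨ x = M.s₂ y ∨ x = M.s₂ (M.s₀ y) := by
  constructor
  · intro h
    refine (iff_of_quot_mk_eq
      (fun x => x = y ∨ x = M.s₀ y ∨ x = M.s₂ y ∨ x = M.s₂ (M.s₀ y)) ?_ h).2 (Or.inl rfl)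
    have key₀ : ∀ a, (a = y ∨ a = M.s₀ y ∨ a = M.s₂ y ∨ a = M.s₂ (M.s₀ y)) →
        (M.s₀ a = y ∨ M.s₀ a = M.s₀ y ∨ M.s₀ a = M.s₂ y ∨ M.s₀ a = M.s₂ (M.s₀ y)) := by
      rintro a (rfl | rfl | rfl | rfl)
      · exact Or.inr (Or.inl rfl)
      · exact Or.inl (M.invol₀ _)
      · exact Or.inr (Or.inr (Or.inr (M.comm₀₂ _)))
      · exact Or.inr (Or.inr (Or.inl (by rw [M.comm₀₂, M.invol₀])))
    have key₂ : ∀ a, (a = y ∨ a = M.s₀ y ∨ a = M.s₂ y ∨ a = M.s₂ (M.s₀ y)) →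
        (M.s₂ a = y ∨ M.s₂ a = M.s₀ y ∨ M.s₂ a = M.s₂ y ∨ M.s₂ a = M.s₂ (M.s₀ y)) := by
      rintro a (rfl | rfl | rfl | rfl)
      · exact Or.inr (Or.inr (Or.inl rfl))
      · exact Or.inr (Or.inr (Or.inr rfl))
      · exact Or.inl (M.invol₂ _)
      · exact Or.inr (Or.inl (M.invol₂ _))
    rintro a _ (rfl | rfl)
    · exact ⟨key₀ a, fun h => by simpa only [M.invol₀] using key₀ _ h⟩
    · exact ⟨key₂ a, fun h => by simpa only [M.invol₂] using key₂ _ h⟩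
  · rintro (rfl | rfl | rfl | rfl) <;> simp

/-! ### Triangulation -/

/-- The map obtained by placing a new vertex in every face and joining it to the corners of the
face. -/
def stellar : SurfaceMap (Φ × Fin 3) where
  -- Index 0 is a flag on an old edge; indices 1 and 2 lie on a new spoke, at its old end and at the
  -- centre of the face.
  s₀ := fun
    | (x, 0) => (M.s₀ x, 0)
    | (x, 1) => (x, 2)
    | (x, 2) => (x, 1)
  s₁ := fun
    | (x, 0) => (x, 1)
    | (x, 1) => (x, 0)
    | (x, 2) => (M.s₀ x, 2)
  s₂ := fun
    | (x, 0) => (M.s₂ x, 0)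
    | (x, 1) => (M.s₁ x, 1)
    | (x, 2) => (M.s₁ x, 2)
  invol₀ := by rintro ⟨x, i⟩; fin_cases i <;> simp [M.invol₀]
  invol₁ := by rintro ⟨x, i⟩; fin_cases i <;> simp [M.invol₀]
  invol₂ := by rintro ⟨x, i⟩; fin_cases i <;> simp [M.invol₁, M.invol₂]
  ne₀ := by rintro ⟨x, i⟩; fin_cases i <;> simp [M.ne₀]
  ne₁ := by rintro ⟨x, i⟩; fin_cases i <;> simp [M.ne₀]
  ne₂ := by rintro ⟨x, i⟩; fin_cases i <;> simp [M.ne₁, M.ne₂]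
  comm₀₂ := by rintro ⟨x, i⟩; fin_cases i <;> simp [M.comm₀₂]
  ne₀₂ := by rintro ⟨x, i⟩; fin_cases i <;> simp [M.ne₀₂]
  nonempty := M.nonempty.map fun x => (x, 0)
  connected := by
    rintro ⟨x, i⟩ ⟨y, j⟩
    refine (Relation.ReflTransGen.trans (b := (x, 0)) ?_ (Relation.ReflTransGen.trans
      (b := (y, 0)) ?_ ?_))
    · fin_cases i
      · exact .refl
      · exact .single (.inr (.inl rfl))
      · exact .head (b := (x, 1)) (.inl rfl) (.single (.inr (.inl rfl)))
    · have h := M.connected x y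
      induction h with
      | refl => exact .refl
      | @tail a b _ h ih =>
        refine ih.trans ?_
        rcases h with rfl | rfl | rfl
        · exact .single (.inl rfl)
        · exact .head (b := (a, 1)) (.inr (.inl rfl)) (.head (b := (M.s₁ a, 1))
            (.inr (.inr rfl)) (.single (.inr (.inl rfl))))
        · exact .single (.inr (.inr rfl))
    · fin_cases j
      · exact .refl
      · exact .single (.inr (.inl rfl))
      · exact .head (b := (y, 1)) (.inr (.inl rfl)) (.single (.inl rfl))

/-- The vertices of the stellar map are the vertices and the faces of the given one. -/
def stellarVertexEquiv : M.stellar.Vertex ≃ M.Vertex ⊕ M.Face where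
  toFun := Quot.lift (fun
    | (x, 0) => .inl (M.vertexOf x)
    | (x, 1) => .inl (M.vertexOf x)
    | (x, 2) => .inr (M.faceOf x)) (by
      rintro ⟨x, i⟩ _ (rfl | rfl) <;> fin_cases i <;> simp [stellar])
  invFun := Sum.elim
    (Quot.lift (fun x => M.stellar.vertexOf (x, 0)) (by
      have h : ∀ y, M.stellar.vertexOf (y, 1) = M.stellar.vertexOf (y, 0) := fun y =>
        M.stellar.vertexOf_s₁ (y, 0)
      rintro x _ (rfl | rfl)
      · rw [← h, ← h]
        exact (M.stellar.vertexOf_s₂ (x, 1)).symm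
      · exact (M.stellar.vertexOf_s₂ (x, 0)).symm))
    (Quot.lift (fun x => M.stellar.vertexOf (x, 2)) (by
      rintro x _ (rfl | rfl)
      · exact (M.stellar.vertexOf_s₁ (x, 2)).symm
      · exact (M.stellar.vertexOf_s₂ (x, 2)).symm))
  left_inv := by
    rintro ⟨x, i⟩
    fin_cases i
    · rfl
    · exact (M.stellar.vertexOf_s₁ (x, 0)).symm
    · rfl
  right_inv := by rintro (⟨⟨x⟩⟩ | ⟨⟨x⟩⟩) <;> rfl

/-- The edges of the stellar map are the edges and the corners of the given one. -/
def stellarEdgeEquiv : M.stellar.Edge ≃ M.Edge ⊕ Quot fun x y => M.s₁ x = y where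
  toFun := Quot.lift (fun
    | (x, 0) => .inl (M.edgeOf x)
    | (x, 1) => .inr (Quot.mk _ x)
    | (x, 2) => .inr (Quot.mk _ x)) (by
      have h : ∀ x, (Quot.mk (fun x y => M.s₁ x = y) x) = Quot.mk _ (M.s₁ x) := fun x =>
        Quot.sound rfl
      rintro ⟨x, i⟩ _ (rfl | rfl) <;> fin_cases i <;> simp [stellar, ← h])
  invFun := Sum.elim
    (Quot.lift (fun x => M.stellar.edgeOf (x, 0)) (by
      rintro x _ (rfl | rfl)
      · exact (M.stellar.edgeOf_s₀ (x, 0)).symm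
      · exact (M.stellar.edgeOf_s₂ (x, 0)).symm))
    (Quot.lift (fun x => M.stellar.edgeOf (x, 1)) (by
      rintro x _ rfl
      exact (M.stellar.edgeOf_s₂ (x, 1)).symm))
  left_inv := by
    rintro ⟨x, i⟩
    fin_cases i
    · rfl
    · rfl
    · exact (M.stellar.edgeOf_s₀ (x, 1)).symm
  right_inv := by rintro (⟨⟨x⟩⟩ | ⟨⟨x⟩⟩) <;> rfl

/-- The faces of the stellar map are the sides of the edges of the given one. -/
def stellarFaceEquiv : M.stellar.Face ≃ Quot fun x y => M.s₀ x = y where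
  toFun := Quot.lift (fun x => Quot.mk _ x.1) (by
      have h : ∀ x, (Quot.mk (fun x y => M.s₀ x = y) x) = Quot.mk _ (M.s₀ x) := fun x =>
        Quot.sound rfl
      rintro ⟨x, i⟩ _ (rfl | rfl) <;> fin_cases i <;> simp [stellar, ← h])
  invFun := Quot.lift (fun x => M.stellar.faceOf (x, 0)) (by
      rintro x _ rfl
      exact (M.stellar.faceOf_s₀ (x, 0)).symm)
  left_inv := by
    rintro ⟨x, i⟩
    fin_cases i
    · rfl
    · exact (M.stellar.faceOf_s₁ (x, 0)).symm
    · exact (M.stellar.faceOf_s₁ (x, 0)).symm.trans (M.stellar.faceOf_s₀ (x, 1)).symm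
  right_inv := by rintro ⟨x⟩; rfl

/-- The corners and the sides of edges both number half the flags. The former are added to the
edges, the latter are the new faces, and the old faces become vertices, so the changes cancel. -/
theorem eulerGenus_stellar [Finite Φ] : M.stellar.eulerGenus = M.eulerGenus := by
  have : Finite (Quot fun x y => M.s₀ x = y) := Quot.finite _
  have : Finite (Quot fun x y => M.s₁ x = y) := Quot.finite _
  have h0 := two_mul_card_quot_involutive M.s₀ M.invol₀ M.ne₀
  have h1 := two_mul_card_quot_involutive M.s₁ M.invol₁ M.ne₁
  have hv := Nat.card_congr M.stellarVertexEquiv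
  have he := Nat.card_congr M.stellarEdgeEquiv
  have hf := Nat.card_congr M.stellarFaceEquiv
  rw [Nat.card_sum] at hv he
  unfold eulerGenus eulerChar
  omega

/-- A map with triangular (or smaller) faces. -/
def IsTriangulation : Prop := ∀ f : M.Face, ∃ c : Fin 3 → M.Vertex,
  ∀ x, M.faceOf x = f → ∃ i, M.vertexOf x = c i

/-- A new face consists of the six flags over `x` and `s₀ x`: two old corners and one centre. -/
theorem isTriangulation_stellar : M.stellar.IsTriangulation := by
  rintro ⟨x, i⟩
  refine ⟨![M.stellar.vertexOf (x, 0), M.stellar.vertexOf (M.s₀ x, 0),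
    M.stellar.vertexOf (x, 2)], ?_⟩
  rintro ⟨y, j⟩ h
  have h' : Quot.mk (fun x y => M.s₀ x = y) y = Quot.mk (fun x y => M.s₀ x = y) x :=
    congrArg M.stellarFaceEquiv h
  have hy := (quot_mk_eq_iff_of_involutive _ M.invol₀).1 h'
  rcases hy with rfl | rfl <;> fin_cases j
  · exact ⟨0, rfl⟩
  · exact ⟨0, M.stellar.vertexOf_s₁ (y, 0)⟩
  · exact ⟨2, rfl⟩
  · exact ⟨1, rfl⟩
  · exact ⟨1, M.stellar.vertexOf_s₁ (M.s₀ x, 0)⟩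
  · exact ⟨2, M.stellar.vertexOf_s₁ (x, 2)⟩

end SurfaceMap

theorem DrawnIn.stellar {V : Type*} {G : SimpleGraph V} {Φ : Type} {M : SurfaceMap Φ}
    (h : DrawnIn G M) : DrawnIn G M.stellar := by
  obtain ⟨f, hf, hadj⟩ := h
  refine ⟨fun v => M.stellarVertexEquiv.symm (.inl (f v)),
    fun v w hvw => hf (Sum.inl_injective (M.stellarVertexEquiv.symm.injective hvw)), ?_⟩
  intro v w hvw
  obtain ⟨x, hx, hx'⟩ := hadj v w hvw
  refine ⟨(x, 0), ?_, ?_⟩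
  · simp only [← hx]; rfl
  · simp only [← hx']; rfl

theorem even_card_of_involution {α : Type*} (S : Finset α) (s : α → α) (hs : ∀ x, s (s x) = x)
    (hne : ∀ x, s x ≠ x) (hS : ∀ x ∈ S, s x ∈ S) : Even S.card := by
  have h := Finset.sum_involution (s := S) (f := fun _ => (1 : ZMod 2)) (fun x _ => s x)
    (fun _ _ => by decide) (fun x _ _ => hne x) hS (fun x _ => hs x)
  rw [Finset.sum_const, nsmul_eq_mul, mul_one] at h
  exact ZMod.natCast_eq_zero_iff_even.1 h

namespace SurfaceMap

variable {Φ : Type} (M : SurfaceMap Φ)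

/-! ### Tree and cotree -/

/-- `up` realizes the edges of the rooted tree `T` by flags: `up v` is a flag at `v`, on an edge
from `v` to its parent. -/
def IsTreeOf (T : RTree M.Vertex) (up : M.Vertex → Φ) : Prop :=
  ∀ v, v ≠ T.root → M.vertexOf (up v) = v ∧ M.vertexOf (M.s₀ (up v)) = T.par v

/-- `up` realizes the edges of the rooted tree `C` in the dual map by flags. -/
def IsCotreeOf (C : RTree M.Face) (up : M.Face → Φ) : Prop :=
  ∀ f, f ≠ C.root → M.faceOf (up f) = f ∧ M.faceOf (M.s₂ (up f)) = C.par f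

/-- The edges joining a vertex (or face) of a tree to its parent. -/
def treeEdges {A : Type} (T : RTree A) (up : A → Φ) : Set M.Edge :=
  {e | ∃ a, a ≠ T.root ∧ M.edgeOf (up a) = e}

/-! ### Walks around a subtree -/

/-- A step between flags at descendants of `v` that changes the face only across edges in `K`. -/
def Near (T : RTree M.Vertex) (K : Set M.Edge) (v : M.Vertex) (x y : Φ) : Prop :=
  T.Anc v (M.vertexOf x) ∧ T.Anc v (M.vertexOf y) ∧
    (M.s₀ x = y ∨ M.s₁ x = y ∨ (M.edgeOf x ∈ K ∧ M.s₂ x = y))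

variable {M} {T : RTree M.Vertex} {up : M.Vertex → Φ} {K : Set M.Edge}

theorem Near.symm {v : M.Vertex} {x y : Φ} (h : M.Near T K v x y) : M.Near T K v y x := by
  obtain ⟨h1, h2, h3⟩ := h
  refine ⟨h2, h1, ?_⟩
  rcases h3 with rfl | rfl | ⟨h, rfl⟩
  · exact Or.inl (M.invol₀ x)
  · exact Or.inr (Or.inl (M.invol₁ x))
  · exact Or.inr (Or.inr ⟨by rwa [M.edgeOf_s₂], M.invol₂ x⟩)

theorem near_reflTransGen_symm {v : M.Vertex} {x y : Φ}
    (h : Relation.ReflTransGen (M.Near T K v) x y) :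
    Relation.ReflTransGen (M.Near T K v) y x :=
  have : Std.Symm (M.Near T K v) := ⟨fun _ _ => Near.symm⟩
  Std.Symm.symm (r := Relation.ReflTransGen (M.Near T K v)) _ _ h

theorem near_reflTransGen_mono {u v : M.Vertex} (huv : T.Anc u v) {x y : Φ}
    (h : Relation.ReflTransGen (M.Near T K v) x y) :
    Relation.ReflTransGen (M.Near T K u) x y :=
  Relation.ReflTransGen.mono (fun _ _ h => ⟨huv.trans h.1, huv.trans h.2.1, h.2.2⟩) _ _ h

/-- The flags at a vertex form a cycle; removing one link does not disconnect it. -/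
theorem cycle_minus_link [Finite Φ] {E : Φ → Φ → Prop} (a : Φ) (hrefl : E a a)
    (h₁ : ∀ x, M.vertexOf x = M.vertexOf a → E a x → E a (M.s₁ x))
    (h₂ : ∀ x, M.vertexOf x = M.vertexOf a → x ≠ a → x ≠ M.s₂ a → E a x → E a (M.s₂ x)) :
    E a (M.s₂ a) := by
  classical
  have := Fintype.ofFinite Φ
  by_contra hcon
  -- Parity: `s₁` pairs up the flags of `S`, while `s₂` would pair up all of them except `a`.
  let S : Finset Φ := Finset.univ.filter fun x => M.vertexOf x = M.vertexOf a ∧ E a x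
  have memS : ∀ x, x ∈ S ↔ M.vertexOf x = M.vertexOf a ∧ E a x := fun x => by simp [S]
  have haS : a ∈ S := (memS a).2 ⟨rfl, hrefl⟩
  have e1 : Even S.card := even_card_of_involution S M.s₁ M.invol₁ M.ne₁ fun x hx => by
    rw [memS] at hx ⊢
    exact ⟨by rw [M.vertexOf_s₁, hx.1], h₁ x hx.1 hx.2⟩
  have e2 : Even (S.erase a).card := even_card_of_involution _ M.s₂ M.invol₂ M.ne₂ fun x hx => by
    rw [Finset.mem_erase, memS] at hx ⊢
    have hx2 : x ≠ M.s₂ a := fun h => hcon (h ▸ hx.2.2)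
    exact ⟨fun h => hx2 (by rw [← h, M.invol₂]), by rw [M.vertexOf_s₂, hx.2.1],
      h₂ x hx.2.1 hx.1 hx2 hx.2.2⟩
  have := Finset.card_erase_add_one haS
  rw [← this] at e1
  exact Nat.not_even_iff_odd.2 e2.add_one e1

/-- If every edge at a descendant of `v` is in the tree or in `K`, then one can walk between any
two flags at `v`. -/
theorem near_of_vertexOf_eq [Finite Φ] (hup : M.IsTreeOf T up) (n : ℕ) (v : M.Vertex)
    (hn : ∀ u, T.depth u < T.depth v + n)
    (hK : ∀ x, T.Anc v (M.vertexOf x) → M.edgeOf x ∈ M.treeEdges T up ∨ M.edgeOf x ∈ K)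
    {x y : Φ} (hx : M.vertexOf x = v) (hy : M.vertexOf y = v) :
    Relation.ReflTransGen (M.Near T K v) x y := by
  -- The induction is on a bound for the height of the tree below `v`.
  induction n generalizing v x y with
  | zero => exact absurd (hn v) (by omega)
  | succ n ih =>
    have anc : ∀ z, M.vertexOf z = v → T.Anc v (M.vertexOf z) := fun z hz =>
      hz ▸ RTree.Anc.refl T _
    have l₁ : ∀ z, M.vertexOf z = v → Relation.ReflTransGen (M.Near T K v) z (M.s₁ z) :=
      fun z hz => .single ⟨anc z hz, anc _ (by rw [M.vertexOf_s₁, hz]), Or.inr (Or.inl rfl)⟩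
    -- Instead of crossing the edge to a child, walk along it, around the subtree of the child, and
    -- back on the other side.
    have lchild : ∀ z, M.vertexOf z = v →
        M.vertexOf (M.s₀ z) ≠ T.root → T.par (M.vertexOf (M.s₀ z)) = v →
        Relation.ReflTransGen (M.Near T K v) z (M.s₂ z) := by
      intro z hz hr hp
      have hvw : T.Anc v (M.vertexOf (M.s₀ z)) := hp ▸ T.anc_par _
      have hw := ih (M.vertexOf (M.s₀ z)) (fun u => by
        have := hn u
        have := T.depth_par _ hr
        rw [hp] at this
        omega) (fun x hx => hK x (hvw.trans hx)) rfl
        (M.vertexOf_s₂ (M.s₀ z))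
      have hz2 : M.vertexOf (M.s₂ z) = v := by rw [M.vertexOf_s₂, hz]
      refine Relation.ReflTransGen.head (b := M.s₀ z) ⟨anc z hz, hvw, Or.inl rfl⟩
        ((near_reflTransGen_mono hvw hw).tail ⟨?_, anc _ hz2, Or.inl ?_⟩)
      · rw [M.vertexOf_s₂]; exact hvw
      · rw [M.comm₀₂, M.invol₀]
    have l₂' : ∀ z, M.vertexOf z = v → Relation.ReflTransGen (M.Near T K v) z (M.s₂ z) ∨
        (v ≠ T.root ∧ (z = up v ∨ z = M.s₂ (up v))) := by
      intro z hz
      have hz2 : M.vertexOf (M.s₂ z) = v := by rw [M.vertexOf_s₂, hz]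
      rcases hK z (anc z hz) with ⟨w, hw, hwe⟩ | h
      · obtain ⟨u1, u2⟩ := hup w hw
        rcases M.edgeOf_eq_iff.1 hwe.symm with rfl | rfl | rfl | rfl
        · rw [u1] at hz; subst hz
          exact Or.inr ⟨hw, Or.inl rfl⟩
        · refine Or.inl (lchild _ hz ?_ ?_)
          · rw [M.invol₀, u1]; exact hw
          · rw [M.invol₀, u1, ← u2, hz]
        · rw [M.vertexOf_s₂, u1] at hz; subst hz
          exact Or.inr ⟨hw, Or.inr rfl⟩
        · refine Or.inl (lchild _ hz ?_ ?_)
          · rw [M.comm₀₂, M.invol₀, M.vertexOf_s₂, u1]; exact hw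
          · rw [M.comm₀₂, M.invol₀, M.vertexOf_s₂, u1, ← u2, ← M.vertexOf_s₂, hz]
      · exact Or.inl (.single ⟨anc z hz, anc _ hz2, Or.inr (Or.inr ⟨h, rfl⟩)⟩)
    -- The edge to the parent cannot be crossed, but the rest of the cycle of flags at `v` connects
    -- its two sides.
    have lup : v ≠ T.root → Relation.ReflTransGen (M.Near T K v) (up v) (M.s₂ (up v)) := by
      intro hv
      have hu := (hup v hv).1
      refine cycle_minus_link (up v) .refl ?_ ?_
      · intro z hz h
        exact h.trans (l₁ z (hz.trans hu))
      · intro z hz h1 h2 h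
        rcases l₂' z (hz.trans hu) with h' | ⟨-, h' | h'⟩
        · exact h.trans h'
        · exact absurd h' h1
        · exact absurd h' h2
    have l₂ : ∀ z, M.vertexOf z = v → Relation.ReflTransGen (M.Near T K v) z (M.s₂ z) := by
      intro z hz
      rcases l₂' z hz with h | ⟨hv, rfl | rfl⟩
      · exact h
      · exact lup hv
      · rw [M.invol₂]
        exact near_reflTransGen_symm (lup hv)
    have hxy : M.vertexOf x = M.vertexOf y := hx.trans hy.symm
    refine ((iff_of_quot_mk_eq
      (fun z => M.vertexOf z = v ∧ Relation.ReflTransGen (M.Near T K v) x z) ?_ hxy).1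
        ⟨hx, .refl⟩).2
    rintro a _ (rfl | rfl)
    · rw [M.vertexOf_s₁]
      exact and_congr_right fun ha =>
        ⟨fun h => h.trans (l₁ a ha), fun h => h.trans (near_reflTransGen_symm (l₁ a ha))⟩
    · rw [M.vertexOf_s₂]
      exact and_congr_right fun ha =>
        ⟨fun h => h.trans (l₂ a ha), fun h => h.trans (near_reflTransGen_symm (l₂ a ha))⟩

/-- If every edge at a descendant of `v` is in the tree or in `K`, then one can walk between any
two flags at descendants of `v`. -/
theorem near_of_anc [Finite Φ] (hup : M.IsTreeOf T up) (v : M.Vertex)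
    (hK : ∀ x, T.Anc v (M.vertexOf x) → M.edgeOf x ∈ M.treeEdges T up ∨ M.edgeOf x ∈ K)
    {x y : Φ} (hx : T.Anc v (M.vertexOf x)) (hy : T.Anc v (M.vertexOf y)) :
    Relation.ReflTransGen (M.Near T K v) x y := by
  obtain ⟨N, hN⟩ := (Set.finite_range T.depth).bddAbove
  have hv : ∀ u, T.Anc v u → ∀ {x y : Φ}, M.vertexOf x = u → M.vertexOf y = u →
      Relation.ReflTransGen (M.Near T K v) x y := fun u hu x y hx hy =>
    near_reflTransGen_mono hu (near_of_vertexOf_eq hup (N + 1) u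
      (fun w => by have := hN (Set.mem_range_self w); omega) (fun z hz => hK z (hu.trans hz)) hx hy)
  obtain ⟨a, ha⟩ : ∃ a, M.vertexOf a = v := Quot.exists_rep v
  have key : ∀ n (x : Φ), T.Anc v (M.vertexOf x) → T.depth (M.vertexOf x) = n →
      Relation.ReflTransGen (M.Near T K v) x a := by
    intro n
    induction n with
    | zero =>
      intro x hx h0
      have h1 := T.depth_eq_zero.1 h0
      have : v = M.vertexOf x := by
        obtain ⟨k, hk⟩ := hx
        rw [← hk, h1, Function.iterate_fixed T.par_root]
      exact hv v (.refl T v) this.symm ha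
    | succ n ih =>
      intro x hx hd
      by_cases hne : v = M.vertexOf x
      · exact hv v (.refl T v) hne.symm ha
      have hr : M.vertexOf x ≠ T.root := fun h => by
        rw [h, T.depth_root] at hd; omega
      obtain ⟨u1, u2⟩ := hup _ hr
      have hp := hx.eq_or_par.resolve_left hne
      -- Turn to the edge leading to the parent and climb it.
      refine (hv _ hx rfl u1).trans (.head (b := M.s₀ (up (M.vertexOf x))) ?_ (ih _ ?_ ?_))
      · exact ⟨by rw [u1]; exact hx, by rw [u2]; exact hp, Or.inl rfl⟩
      · rw [u2]; exact hp
      · have := T.depth_par _ hr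
        rw [u2]; omega
  exact (key _ x hx rfl).trans (near_reflTransGen_symm (key _ y hy rfl))

/-- A breadth-first search tree of the vertices and a tree of the faces without common edges. -/
theorem exists_tree_cotree [Finite Φ] (M : SurfaceMap Φ) :
    ∃ (T : RTree M.Vertex) (up : M.Vertex → Φ) (C : RTree M.Face) (up' : M.Face → Φ),
      M.IsTreeOf T up ∧ M.IsCotreeOf C up' ∧
      (∀ x, T.depth (M.vertexOf x) ≤ T.depth (M.vertexOf (M.s₀ x)) + 1) ∧
      Disjoint (M.treeEdges T up) (M.treeEdges C up') := by
  have := M.nonempty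
  obtain ⟨o⟩ := M.nonempty
  obtain ⟨T, up, hup, hd⟩ := exists_bfsTree M.vertexOf M.s₀ Set.univ M.invol₀
    (fun _ _ => trivial) (M.vertexOf o) (by
      rintro ⟨x⟩
      change Relation.ReflTransGen _ (M.vertexOf x) _
      have h := M.connected x o
      induction h using Relation.ReflTransGen.head_induction_on with
      | refl => exact .refl
      | @head a b h _ ih =>
        rcases h with rfl | rfl | rfl
        · exact .head ⟨a, trivial, rfl, rfl⟩ ih
        · exact (M.vertexOf_s₁ a) ▸ ih
        · exact (M.vertexOf_s₂ a) ▸ ih)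
  have hT : M.IsTreeOf T up := fun v hv => (hup v hv).2
  obtain ⟨C, up', hup', -⟩ := exists_bfsTree M.faceOf M.s₂ {x | M.edgeOf x ∉ M.treeEdges T up}
    M.invol₂ (fun x hx => by
      have hx' : M.edgeOf x ∉ M.treeEdges T up := hx
      change M.edgeOf _ ∉ _
      rwa [M.edgeOf_s₂]) (M.faceOf o) (by
      rintro ⟨x⟩
      change Relation.ReflTransGen _ (M.faceOf x) _
      -- The walk around the whole of `T` reaches every face and crosses only edges outside `T`, so
      -- these connect the dual.
      have h := near_of_anc (K := (M.treeEdges T up)ᶜ) hT T.root (fun x _ => em _)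
        (T.root_anc (M.vertexOf x)) (T.root_anc (M.vertexOf o))
      induction h using Relation.ReflTransGen.head_induction_on with
      | refl => exact .refl
      | @head a b h _ ih =>
        rcases h.2.2 with rfl | rfl | ⟨ha, rfl⟩
        · exact (M.faceOf_s₀ a) ▸ ih
        · exact (M.faceOf_s₁ a) ▸ ih
        · exact .head ⟨a, ha, rfl, rfl⟩ ih)
  refine ⟨T, up, C, up', hT, fun f hf => (hup' f hf).2, fun x => hd x trivial, ?_⟩
  rw [Set.disjoint_right]
  rintro _ ⟨f, hf, rfl⟩
  exact (hup' f hf).1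

/-- Otherwise each of `v`, `w` would be the parent of the other, against the depths. -/
theorem edgeOf_up_injOn (hup : M.IsTreeOf T up) {v w : M.Vertex} (hv : v ≠ T.root)
    (hw : w ≠ T.root) (h : M.edgeOf (up v) = M.edgeOf (up w)) : v = w := by
  obtain ⟨v1, v2⟩ := hup v hv
  obtain ⟨w1, w2⟩ := hup w hw
  have dv := T.depth_par v hv
  have dw := T.depth_par w hw
  rcases M.edgeOf_eq_iff.1 h with h | h | h | h
  · rw [← v1, h, w1]
  · have e1 : v = T.par w := by rw [← v1, h, w2]
    have e2 : T.par v = w := by rw [← v2, h, M.invol₀, w1]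
    rw [← e1] at dw
    rw [e2] at dv
    omega
  · rw [← v1, h, M.vertexOf_s₂, w1]
  · have e1 : v = T.par w := by rw [← v1, h, M.vertexOf_s₂, w2]
    have e2 : T.par v = w := by rw [← v2, h, M.comm₀₂, M.invol₀, M.vertexOf_s₂, w1]
    rw [← e1] at dw
    rw [e2] at dv
    omega

theorem edgeOf_coup_injOn {C : RTree M.Face} {up' : M.Face → Φ} (hup : M.IsCotreeOf C up')
    {v w : M.Face} (hv : v ≠ C.root) (hw : w ≠ C.root)
    (h : M.edgeOf (up' v) = M.edgeOf (up' w)) : v = w := by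
  obtain ⟨v1, v2⟩ := hup v hv
  obtain ⟨w1, w2⟩ := hup w hw
  have dv := C.depth_par v hv
  have dw := C.depth_par w hw
  rcases M.edgeOf_eq_iff.1 h with h | h | h | h
  · rw [← v1, h, w1]
  · rw [← v1, h, M.faceOf_s₀, w1]
  · have e1 : v = C.par w := by rw [← v1, h, w2]
    have e2 : C.par v = w := by rw [← v2, h, M.invol₂, w1]
    rw [← e1] at dw
    rw [e2] at dv
    omega
  · have e1 : v = C.par w := by rw [← v1, h, ← M.comm₀₂, M.faceOf_s₀, w2]
    have e2 : C.par v = w := by rw [← v2, h, M.invol₂, M.faceOf_s₀, w1]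
    rw [← e1] at dw
    rw [e2] at dv
    omega

/-- By Euler's formula, the number of edges in neither tree is at most the Euler genus. -/
theorem card_rest_le [Finite Φ] {C : RTree M.Face} {up' : M.Face → Φ} (hT : M.IsTreeOf T up)
    (hC : M.IsCotreeOf C up') (hdisj : Disjoint (M.treeEdges T up) (M.treeEdges C up')) :
    (Nat.card ↥(M.treeEdges T up ∪ M.treeEdges C up')ᶜ : ℤ) ≤ M.eulerGenus := by
  classical
  let F : ({v // v ≠ T.root} ⊕ {f // f ≠ C.root}) ⊕ ↥(M.treeEdges T up ∪ M.treeEdges C up')ᶜ →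
      M.Edge :=
    Sum.elim (Sum.elim (fun v => M.edgeOf (up v.1)) (fun f => M.edgeOf (up' f.1))) Subtype.val
  have hF : Function.Injective F := by
    refine Function.Injective.sumElim (Function.Injective.sumElim ?_ ?_ ?_)
      Subtype.val_injective ?_
    · exact fun v w h => Subtype.ext (edgeOf_up_injOn hT v.2 w.2 h)
    · exact fun v w h => Subtype.ext (edgeOf_coup_injOn hC v.2 w.2 h)
    · exact fun v f h => Set.disjoint_left.1 hdisj ⟨v.1, v.2, rfl⟩ ⟨f.1, f.2, h.symm⟩
    · rintro (v | f) e h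
      · exact e.2 (Or.inl ⟨v.1, v.2, h⟩)
      · exact e.2 (Or.inr ⟨f.1, f.2, h⟩)
  have h := Nat.card_le_card_of_injective F hF
  rw [Nat.card_sum, Nat.card_sum] at h
  -- The trees have `|V| - 1` and `|F| - 1` edges, so at most `|E| - |V| - |F| + 2` remain.
  have hv := Nat.card_congr (Equiv.optionSubtypeNe T.root)
  have hf := Nat.card_congr (Equiv.optionSubtypeNe C.root)
  rw [Finite.card_option] at hv hf
  unfold eulerGenus eulerChar
  omega

/-- If no edge outside both trees has an end below `v`, then the faces with a corner below `v` are
connected in the cotree. -/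
theorem conn_faces [Finite Φ] {C : RTree M.Face} {up' : M.Face → Φ} (hT : M.IsTreeOf T up)
    (hC : M.IsCotreeOf C up') (v : M.Vertex)
    (hv : ∀ x, T.Anc v (M.vertexOf x) → M.edgeOf x ∈ M.treeEdges T up ∪ M.treeEdges C up') :
    C.Conn {f | ∃ x, M.faceOf x = f ∧ T.Anc v (M.vertexOf x)} := by
  rintro _ ⟨x, rfl, hx⟩ _ ⟨y, rfl, hy⟩
  have h := near_of_anc (K := M.treeEdges C up') hT v hv hx hy
  induction h with
  | refl => exact .refl
  | @tail a b _ h ih =>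
    refine (ih h.1).trans ?_
    obtain ⟨ha, hb, rfl | rfl | ⟨⟨f, hf, hfe⟩, rfl⟩⟩ := h
    · rw [M.faceOf_s₀]
    · rw [M.faceOf_s₁]
    · refine .single ⟨⟨_, rfl, ha⟩, ⟨_, rfl, hb⟩, ?_⟩
      obtain ⟨h1, h2⟩ := hC f hf
      rcases M.edgeOf_eq_iff.1 hfe.symm with rfl | rfl | rfl | rfl
      · exact Or.inl (by rw [h1, h2])
      · exact Or.inl (by rw [M.faceOf_s₀, h1, ← M.comm₀₂, M.faceOf_s₀, h2])
      · exact Or.inr (by rw [M.invol₂, h1, h2])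
      · exact Or.inr (by rw [M.invol₂, ← M.comm₀₂, M.faceOf_s₀, M.faceOf_s₀, h1, h2])

end SurfaceMap
end GraphLayout

/-! ### Assembling the track layout -/

namespace GraphLayout

/-- A graph on fewer than `2 ^ k` vertices drawn in a triangulation has a layout with `6` tracks
for each edge outside a tree and a cotree, and `9 k` further tracks. -/
theorem DrawnIn.nonempty_trackLayout {V : Type*} [Finite V] {G : SimpleGraph V} {Φ : Type}
    [Finite Φ] {M : SurfaceMap Φ} (hG : DrawnIn G M) (hM : M.IsTriangulation) (k : ℕ)
    (hk : Nat.card V < 2 ^ k) :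
    ∃ m : ℕ, (m : ℤ) ≤ M.eulerGenus ∧ Nonempty (TrackLayout G (6 * m + 9 * k)) := by
  classical
  obtain ⟨φ, hφ, hadj⟩ := hG
  obtain ⟨T, up, C, up', hT, hC, hdepth, hdisj⟩ := M.exists_tree_cotree
  let X : Set M.Edge := (M.treeEdges T up ∪ M.treeEdges C up')ᶜ
  -- These vertices lie on the vertical paths from the ends of the leftover edges.
  let Z : Set V := {v | ∃ x, M.edgeOf x ∈ X ∧ T.Anc (φ v) (M.vertexOf x)}
  have := Fintype.ofFinite X
  have := Fintype.ofFinite V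
  refine ⟨Nat.card X, SurfaceMap.card_rest_le hT hC hdisj, ?_⟩
  -- the two ends of an edge
  let rep : M.Edge → Φ := fun e => (Quot.exists_rep e).choose
  have hrep : ∀ e, M.edgeOf (rep e) = e := fun e => (Quot.exists_rep e).choose_spec
  let tip : X × Bool → M.Vertex := fun z =>
    M.vertexOf (if z.2 then M.s₀ (rep z.1) else rep z.1)
  have hZ : ∀ v, v ∈ Z → ∃ z, T.Anc (φ v) (tip z) := by
    rintro v ⟨x, hx, hv⟩
    have : M.vertexOf x = M.vertexOf (rep (M.edgeOf x)) ∨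
        M.vertexOf x = M.vertexOf (M.s₀ (rep (M.edgeOf x))) := by
      rcases M.edgeOf_eq_iff.1 (hrep (M.edgeOf x)).symm with h | h | h | h
      · exact Or.inl (congrArg _ h)
      · exact Or.inr (congrArg _ h)
      · exact Or.inl ((congrArg _ h).trans (M.vertexOf_s₂ _))
      · exact Or.inr ((congrArg _ h).trans (M.vertexOf_s₂ _))
    rcases this with h | h
    · exact ⟨(⟨_, hx⟩, false), by rw [h] at hv; exact hv⟩
    · exact ⟨(⟨_, hx⟩, true), by rw [h] at hv; exact hv⟩
  choose ζ hζ using hZ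
  -- the other vertices
  let U : Type _ := {v // v ∉ Z}
  let B : U → Set M.Face := fun v => {f | ∃ x, M.faceOf x = f ∧ T.Anc (φ v.1) (M.vertexOf x)}
  have hB : ∀ v, C.Conn (B v) := by
    intro v
    refine SurfaceMap.conn_faces hT hC _ fun x hx => ?_
    by_contra h
    exact v.2 ⟨x, h, hx⟩
  have hBne : ∀ v, (B v).Nonempty := by
    intro v
    obtain ⟨x, hx⟩ : ∃ x, M.vertexOf x = φ v.1 := Quot.exists_rep _
    exact ⟨_, x, rfl, hx ▸ .refl T _⟩
  have hBadj : ∀ v w : U, G.Adj v.1 w.1 → (B v ∩ B w).Nonempty := by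
    intro v w h
    obtain ⟨x, hx, hx'⟩ := hadj _ _ h
    exact ⟨M.faceOf x, ⟨x, rfl, hx ▸ .refl T _⟩, M.s₀ x, M.faceOf_s₀ x, hx' ▸ .refl T _⟩
  have hU : (Finset.univ : Finset U).card < 2 ^ k := by
    refine lt_of_le_of_lt ?_ hk
    rw [Finset.card_univ, Nat.card_eq_fintype_card]
    exact Fintype.card_subtype_le _
  obtain ⟨p, p1, p2, p3, p4⟩ := C.exists_hierarchy B hB hBne k Finset.univ hU
  simp only [Finset.mem_univ, forall_const] at p1 p2 p3 p4
  choose F hF using p4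
  choose c hc using hM
  -- The common face of a separation node has a corner below each of its members; that corner
  -- selects one of three vertical paths.
  have hidx : ∀ v : U, ∃ i, T.Anc (φ v.1) (c (F (p v)) i) := by
    intro v
    obtain ⟨x, hx, hvx⟩ := hF (p v) v rfl
    obtain ⟨i, hi⟩ := hc _ x hx
    exact ⟨i, hi ▸ hvx⟩
  choose idx hidx using hidx
  let col : V → (X × Bool) ⊕ (Fin k × Fin 3) := fun v =>
    if h : v ∈ Z then .inl (ζ v h) else .inr (⟨(p ⟨v, h⟩).length, p1 ⟨v, h⟩⟩, idx ⟨v, h⟩)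
  -- On `Z` label and depth already determine the vertex, so a constant position suffices and makes
  -- monotonicity trivial.
  let pos : V → List ℕ := fun v => if h : v ∈ Z then [] else p ⟨v, h⟩
  have colZ : ∀ v (h : v ∈ Z), col v = .inl (ζ v h) := fun v h => dif_pos h
  have colU : ∀ v (h : v ∉ Z),
      col v = .inr (⟨(p ⟨v, h⟩).length, p1 ⟨v, h⟩⟩, idx ⟨v, h⟩) := fun v h => dif_neg h
  have posZ : ∀ v, v ∈ Z → pos v = [] := fun v h => dif_pos h
  have posU : ∀ v (h : v ∉ Z), pos v = p ⟨v, h⟩ := fun v h => dif_neg h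
  have same : ∀ v w, col v = col w → (v ∈ Z ↔ w ∈ Z) := by
    intro v w h
    by_cases hv : v ∈ Z <;> by_cases hw : w ∈ Z
    · simp [hv, hw]
    · rw [colZ v hv, colU w hw] at h; simp at h
    · rw [colU v hv, colZ w hw] at h; simp at h
    · simp [hv, hw]
  have lenU : ∀ v w (hv : v ∉ Z) (hw : w ∉ Z), col v = col w →
      (p ⟨v, hv⟩).length = (p ⟨w, hw⟩).length ∧ idx ⟨v, hv⟩ = idx ⟨w, hw⟩ := by
    intro v w hv hw h
    rw [colU v hv, colU w hw] at h
    simpa using h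
  have main := nonempty_trackLayout_of_layering G (fun v => T.depth (φ v)) col pos ?_ ?_ ?_ ?_
  -- Two ends for each leftover edge, three corners for each level, and three residues of the depth.
  · have hcard : 3 * Fintype.card ((X × Bool) ⊕ (Fin k × Fin 3)) = 6 * Nat.card X + 9 * k := by
      rw [Nat.card_eq_fintype_card]
      simp only [Fintype.card_sum, Fintype.card_prod, Fintype.card_bool, Fintype.card_fin]
      ring
    rwa [hcard] at main
  · intro v w h
    obtain ⟨x, hx, hx'⟩ := hadj v w h
    rw [← hx, ← hx']
    exact hdepth x
  · intro v w hcol hl hp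
    refine hφ ?_
    by_cases hv : v ∈ Z
    · have hw := (same v w hcol).1 hv
      rw [colZ v hv, colZ w hw] at hcol
      have h1 := hζ v hv
      rw [Sum.inl_injective hcol] at h1
      exact h1.eq_of_depth_eq (hζ w hw) hl
    · have hw : w ∉ Z := fun h => hv ((same v w hcol).2 h)
      have h1 := hidx ⟨v, hv⟩
      rw [posU v hv, posU w hw] at hp
      rw [hp, (lenU v w hv hw hcol).2] at h1
      exact h1.eq_of_depth_eq (hidx ⟨w, hw⟩) hl
  · intro v w h hcol
    by_cases hv : v ∈ Z
    · rw [posZ v hv, posZ w ((same v w hcol).1 hv)]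
    · have hw : w ∉ Z := fun h => hv ((same v w hcol).2 h)
      rw [posU v hv, posU w hw]
      exact p2 _ _ (hBadj ⟨v, hv⟩ ⟨w, hw⟩ h) (lenU v w hv hw hcol).1
  · intro v w x y hvw hxy h1 h2 hlt
    by_cases hv : v ∈ Z
    · rw [posZ v hv, posZ x ((same v x h1).1 hv)] at hlt
      exact absurd hlt (lt_irrefl _)
    by_cases hw : w ∈ Z
    · rw [posZ w hw, posZ y ((same w y h2).1 hw)]
    have hx : x ∉ Z := fun h => hv ((same v x h1).2 h)
    have hy : y ∉ Z := fun h => hw ((same w y h2).2 h)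
    rw [posU v hv, posU x hx] at hlt
    rw [posU w hw, posU y hy]
    exact p3 _ _ _ _ (hBadj ⟨v, hv⟩ ⟨w, hw⟩ hvw) (hBadj ⟨x, hx⟩ ⟨y, hy⟩ hxy)
      (lenU v x hv hx h1).1 (lenU w y hw hy h2).1 hlt

theorem trackNumber_le {V : Type*} [Finite V] (G : SimpleGraph V) (k : ℕ)
    (hk : Nat.card V < 2 ^ k) : trackNumber G ≤ 6 * eulerGenus G + 9 * k := by
  obtain ⟨Φ, hΦ, M, hM, hG⟩ : EmbedsInEulerGenus G (eulerGenus G) :=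
    Nat.sInf_mem (exists_embedsInEulerGenus G)
  obtain ⟨m, hm, hL⟩ := hG.stellar.nonempty_trackLayout M.isTriangulation_stellar k hk
  have h : trackNumber G ≤ 6 * m + 9 * k := Nat.sInf_le hL
  rw [M.eulerGenus_stellar] at hm
  omega

end GraphLayout

theorem mainTheorem5 {V : Type*} [Fintype V] [Nonempty V] (G : SimpleGraph V) (n g : ℕ)
    (hn : Fintype.card V = n) (hg : GraphLayout.eulerGenus G = g) :
    GraphLayout.queueNumber G < GraphLayout.trackNumber G ∧
      (GraphLayout.trackNumber G : ℝ) ≤ 6 * g + 9 * (1 + Real.logb (3 / 2) n) := by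
  refine ⟨GraphLayout.queueNumber_lt_trackNumber G, ?_⟩
  have hn1 : 1 ≤ n := hn ▸ Fintype.card_pos
  have h := GraphLayout.trackNumber_le G (Nat.log 2 n + 1) (by
    rw [Nat.card_eq_fintype_card, hn]
    exact Nat.lt_pow_succ_log_self (by norm_num) n)
  rw [hg] at h
  have h' : (GraphLayout.trackNumber G : ℝ) ≤ 6 * g + 9 * (Nat.log 2 n + 1) := by
    exact_mod_cast h
  -- Halving gives a logarithm to base 2, which is at most the one to base `3 / 2`.
  have hlog : (Nat.log 2 n : ℝ) ≤ Real.logb (3 / 2) n := by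
    rw [Real.le_logb_iff_rpow_le (by norm_num) (by exact_mod_cast hn1), Real.rpow_natCast]
    calc ((3 / 2 : ℝ)) ^ Nat.log 2 n ≤ 2 ^ Nat.log 2 n := by gcongr; norm_num
      _ ≤ n := by exact_mod_cast Nat.pow_log_le_self 2 (by omega)
  linarith
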